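/- Let $X$ be a non-empty metric space that is discretely geodesic: the metric is integer valued, and for all $x,y\in X$ there is an isometric embedding $\gamma\colon\{0,1,\dots,d(x,y)\}\to X$ with $\gamma(0)=x$ and $\gamma(d(x,y))=y$. Assume that every bounded subset of $X$ is finite and that, for some constant $\beta\ge 0$, $X$ has $\beta$-stable intervals: with $I(x,y)=\{v\in X: d(x,v)+d(v,y)=d(x,y)\}$ and $d_{\mathrm H}$ the Hausdorff distance, $d_{\mathrm H}(I(x,y),I(x,y'))\le\beta$ for all $x,y,y'\in X$ with $d(y,y')=1$. Let $\mathrm E(X)$ be the injective hull of $X$, that is, the set of all pointwise minimal elements of $\{f\in\mathbb R^X: f(x)+f(y)\ge d(x,y)\text{ for all }x,y\in X\}$, equipped with the metric $\|f-g\|_\infty=\sup_{x\in X}|f(x)-g(x)|$ (which is finite). Then $\mathrm E(X)$ is proper (closed bounded subsets are compact), and $\mathrm E(X)$ has the structure of a locally finite polyhedral complex with, for every $n$, only finitely many isometry types of $n$-cells, each isometric to an injective polytope in $\ell_\infty^n$. Explicitly, there is a family $\mathscr P$ of subsets of $\mathbb R^X$ such that: 1. each $P\in\mathscr P$ is a polytope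 (the convex hull of a finite non-empty set); every non-empty face of a member of $\mathscr P$ belongs to $\mathscr P$; if two members of $\mathscr P$ intersect, their intersection is a face of both; and $\bigcup\mathscr P=\mathrm E(X)$; 2. every point of $\mathrm E(X)$ has a neighbourhood that meets only finitely many members of $\mathscr P$; 3. for every integer $n\ge 0$, the $n$-dimensional members of $\mathscr P$ (with the metric of $\mathrm E(X)$) fall into finitely many isometry classes; 4. for every integer $n\ge 0$, each $n$-dimensional member of $\mathscr P$ is isometric to a polytope $Q\subset\ell_\infty^n$ that is an injective metric space: every $1$-Lipschitz map to $Q$ from a subset $A$ of a metric space $B$ extends to a $1$-Lipschitz map $B\to Q$. -/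

import Mathlib

universe u v w

/-! ### Discretely geodesic spaces and stable intervals -/

/-- The interval `I(x,y) = {v : d(x,v) + d(v,y) = d(x,y)}`. -/
def metricInterval {X : Type u} [MetricSpace X] (x y : X) : Set X :=
  {v | dist x v + dist v y = dist x y}

/-- The metric is integer valued, and any two points `x`, `y` are joined by an isometric embedding
of `{0, 1, …, d(x,y)}`. -/
def IsDiscretelyGeodesic (X : Type u) [MetricSpace X] : Prop :=
  ∀ x y : X, ∃ n : ℕ, dist x y = n ∧
    ∃ γ : Fin (n + 1) → X,
      (∀ i j : Fin (n + 1), dist (γ i) (γ j) = |((i : ℕ) : ℝ) - ((j : ℕ) : ℝ)|) ∧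
      γ 0 = x ∧ γ (Fin.last n) = y

/-- `β`-stable intervals: `d_H(I(x,y), I(x,y')) ≤ β` whenever `d(y,y') = 1`. Intervals are nonempty
and bounded, so the real-valued Hausdorff distance is the true one. -/
def HasStableIntervals (X : Type u) [MetricSpace X] (β : ℝ) : Prop :=
  ∀ x y y' : X, dist y y' = 1 →
    Metric.hausdorffDist (metricInterval x y) (metricInterval x y') ≤ β

/-! ### Injective metric spaces -/

/-- `Y` is injective: every `1`-Lipschitz map to `Y` from a subset `A` of a metric space `B` extends
to a `1`-Lipschitz map on `B`. The universe of the test spaces `B` is a parameter. -/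
def IsInjectiveMetricSpace (Y : Type v) [MetricSpace Y] : Prop :=
  ∀ (B : Type w) [MetricSpace B] (A : Set B) (f : A → Y), LipschitzWith 1 f →
    ∃ g : B → Y, LipschitzWith 1 g ∧ ∀ a : A, g a = f a

/-! ### The injective hull -/

/-- `Δ(X)`: the functions `f` with `f x + f y ≥ d(x,y)` for all `x`, `y`. -/
def deltaFunctions (X : Type u) [MetricSpace X] : Set (X → ℝ) :=
  {f | ∀ x y, dist x y ≤ f x + f y}

/-- The extremal functions: the minimal elements of `Δ(X)` for the pointwise order. -/
def extremalFunctions (X : Type u) [MetricSpace X] : Set (X → ℝ) :=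
  {f | f ∈ deltaFunctions X ∧ ∀ g ∈ deltaFunctions X, g ≤ f → g = f}

/-- The injective hull `E(X)` (Isbell's construction, the tight span): the set of extremal functions.
A type of its own, so that it carries the supremum metric rather than the product topology. -/
def InjectiveHull (X : Type u) [MetricSpace X] : Type u :=
  {f : X → ℝ // f ∈ extremalFunctions X}

namespace InjectiveHull

variable {X : Type u} [MetricSpace X]

theorem le_add_dist (f : InjectiveHull X) (x y : X) : f.1 x ≤ f.1 y + dist x y := by
  classical
  obtain ⟨f, hf, hmin⟩ := f
  change f x ≤ f y + dist x y
  have hg : Function.update f x (min (f x) (f y + dist x y)) ∈ deltaFunctions X := by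
    have key : ∀ z, dist x z ≤ min (f x) (f y + dist x y) + f z := by
      intro z
      rw [← min_add_add_right]
      refine le_min (hf x z) ?_
      have h1 := hf y z
      have h2 := dist_triangle x y z
      linarith
    intro a b
    by_cases ha : a = x <;> by_cases hb : b = x
    · subst ha; subst hb
      have h1 := hf b b
      have h2 := hf y y
      rw [dist_self] at h1 h2 ⊢
      have h3 : 0 ≤ min (f b) (f y + dist b y) :=
        le_min (by linarith) (by have := dist_nonneg (x := b) (y := y); linarith)
      simp only [Function.update_self]
      linarith
    · subst ha
      simpa [Function.update_of_ne hb] using key b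
    · subst hb
      simpa [Function.update_of_ne ha, dist_comm, add_comm] using key a
    · simpa [Function.update_of_ne ha, Function.update_of_ne hb] using hf a b
  have hle : Function.update f x (min (f x) (f y + dist x y)) ≤ f := by
    intro a
    by_cases ha : a = x
    · subst ha; simp
    · simp [Function.update_of_ne ha]
  have h := congrFun (hmin _ hg hle) x
  rw [Function.update_self] at h
  exact min_eq_left_iff.mp h

theorem sub_le_add (f g : InjectiveHull X) (x z : X) : f.1 x - g.1 x ≤ f.1 z + g.1 z := by
  have h1 := le_add_dist f x z
  have h2 := g.2.1 x z
  linarith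

theorem bddAbove_abs_sub [Nonempty X] (f g : InjectiveHull X) :
    BddAbove (Set.range fun x => |f.1 x - g.1 x|) := by
  obtain ⟨z⟩ := ‹Nonempty X›
  refine ⟨f.1 z + g.1 z, ?_⟩
  rintro _ ⟨x, rfl⟩
  have h1 := sub_le_add f g x z
  have h2 := sub_le_add g f x z
  exact abs_le.mpr ⟨by linarith, h1⟩

/-- The supremum metric `d(f,g) = sup_x |f x - g x|`; the supremum is finite by
`bddAbove_abs_sub`. -/
noncomputable instance [Nonempty X] : MetricSpace (InjectiveHull X) where
  dist f g := ⨆ x, |f.1 x - g.1 x|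
  dist_self f := by simp
  dist_comm f g := by simp only [abs_sub_comm]
  dist_triangle f g h := by
    refine ciSup_le fun x => ?_
    exact (abs_sub_le _ _ _).trans
      (add_le_add (le_ciSup (bddAbove_abs_sub f g) x) (le_ciSup (bddAbove_abs_sub g h) x))
  eq_of_dist_eq_zero := by
    intro f g h
    refine Subtype.ext (funext fun x => ?_)
    have h1 : |f.1 x - g.1 x| ≤ 0 := (le_ciSup (bddAbove_abs_sub f g) x).trans_eq h
    exact sub_eq_zero.mp (abs_eq_zero.mp (le_antisymm h1 (abs_nonneg _)))

/-- A set of functions `c ⊆ ℝ^X`, viewed as a subset of the metric space `E(X)`. -/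
def trace (c : Set (X → ℝ)) : Set (InjectiveHull X) :=
  {f | f.1 ∈ c}

end InjectiveHull

/-! ### Polytopes and polyhedral complexes -/

section Polyhedral

variable {V : Type v} [AddCommGroup V] [Module ℝ V]

/-- A (convex, compact, nonempty) polytope: the convex hull of a finite nonempty set. -/
def IsPolytope (c : Set V) : Prop :=
  ∃ s : Set V, s.Finite ∧ s.Nonempty ∧ c = convexHull ℝ s

/-- `F` is a nonempty face of the convex set `c`: a convex subset such that any segment in `c` with
a relatively interior point in `F` lies in `F`. -/
def IsFaceOf (F c : Set V) : Prop :=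
  F.Nonempty ∧ Convex ℝ F ∧ IsExtreme ℝ c F

/-- The dimension of a polytope: the dimension of its affine hull. -/
noncomputable def polytopeDim (c : Set V) : ℕ :=
  Module.finrank ℝ (vectorSpan ℝ c)

/-- `cells` is a polyhedral complex with underlying set `S`: its members are polytopes with union `S`,
faces of cells are cells, and two cells that meet do so in a common face. -/
structure IsPolyhedralComplex (cells : Set (Set V)) (S : Set V) : Prop where
  isPolytope : ∀ c ∈ cells, IsPolytope c
  face_mem : ∀ c ∈ cells, ∀ F : Set V, IsFaceOf F c → F ∈ cells
  inter_face : ∀ c ∈ cells, ∀ c' ∈ cells, (c ∩ c').Nonempty →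
    IsFaceOf (c ∩ c') c ∧ IsFaceOf (c ∩ c') c'
  sUnion_eq : ⋃₀ cells = S

end Polyhedral

/-- Up to isometry (for the induced metrics), a family of subsets of a metric space has only finitely
many members. -/
def FinitelyManyIsometryTypes {Y : Type v} [MetricSpace Y] (𝒞 : Set (Set Y)) : Prop :=
  ∃ T ⊆ 𝒞, T.Finite ∧ ∀ c ∈ 𝒞, ∃ t ∈ T, Nonempty (c ≃ᵢ t)

/-! ### Coarse geometry of intervals in a discretely geodesic space -/

section Geometry

variable {X : Type u} [MetricSpace X]

/-! An extremal `f` is governed by the graph `edgeSet f` of pairs with f x + f y = d(x,y): the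
equations on this graph cut the cell `hullCell f` out of Δ(X). Local finiteness reduces to the
finiteness of these graphs under a bound on f z, for a base point z.

Stable intervals provide this. If (x,y) is nearly sharp for f, then I(x,y) contains a point v at
distance from z bounded in terms of f z (`exists_mem_metricInterval_near`). Whether v lies in I(x,y)
depends on x only through its distances, up to a constant, to a ball about v
(`mem_metricInterval_of_sub_eq`). Balls are finite and distances integral, so only finitely many
such types of x exist, and the graph is pulled back from a relation on this finite set of types. The
consequences are collected in `HasFiniteEdgePatterns`. They make the cells polytopes, only finitely
many of which meet a given ball.

On the direction space of an n-cell, every evaluation is zero or, up to sign, one of n evaluations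
forming a basis of the dual (`exists_edgeDirections_coordinates`). These n embed the cell
isometrically in ℓ_∞^n. Vertices have half-integral values (`exists_eq_half_of_mem_extremePoints`),
and the diameter is at most 2n + 1 (`sub_le_of_mem_hullCell`), so finitely many vertex sets occur
for each n. Cells are injective because `meanExtension`, applied at each point of X, preserves
bounds on sums of two values. -/

theorem IsDiscretelyGeodesic.exists_nat_dist (hgeo : IsDiscretelyGeodesic X) (x y : X) :
    ∃ n : ℕ, dist x y = n := by
  obtain ⟨n, hn, -⟩ := hgeo x y
  exact ⟨n, hn⟩

/-- The last step of a discrete geodesic. -/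
theorem IsDiscretelyGeodesic.exists_pred (hgeo : IsDiscretelyGeodesic X) {x y : X} {n : ℕ}
    (h : dist x y = (n + 1 : ℕ)) : ∃ y', dist x y' = n ∧ dist y' y = 1 := by
  obtain ⟨m, hm, γ, hγ, h0, hl⟩ := hgeo x y
  have hmn : m = n + 1 := by exact_mod_cast hm.symm.trans h
  subst hmn
  refine ⟨γ (Fin.castSucc (Fin.last n)), ?_, ?_⟩
  · rw [← h0, hγ]; simp
  · rw [← hl, hγ]; simp

theorem isBounded_metricInterval (x y : X) : Bornology.IsBounded (metricInterval x y) := by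
  refine (Metric.isBounded_closedBall (x := x) (r := dist x y)).subset fun v hv => ?_
  have hv' : dist x v + dist v y = dist x y := hv
  rw [Metric.mem_closedBall, dist_comm]
  linarith [dist_nonneg (x := v) (y := y)]

theorem left_mem_metricInterval (x y : X) : x ∈ metricInterval x y := by
  simp [metricInterval]

theorem right_mem_metricInterval (x y : X) : y ∈ metricInterval x y := by
  simp [metricInterval]

theorem HasStableIntervals.exists_near {β : ℝ} (hstable : HasStableIntervals X β) {x y y' v : X}
    (hy : dist y y' = 1) (hv : v ∈ metricInterval x y) :
    ∃ w ∈ metricInterval x y', dist v w ≤ β + 1 := by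
  -- Any number strictly above the Hausdorff distance serves as radius; `β + 1` is one.
  obtain ⟨w, hw, h⟩ := Metric.exists_dist_lt_of_hausdorffDist_lt (r := β + 1) hv
    (by linarith [hstable x y y' hy])
    (Metric.hausdorffEDist_ne_top_of_nonempty_of_bounded ⟨_, left_mem_metricInterval x y⟩
      ⟨_, left_mem_metricInterval x y'⟩ (isBounded_metricInterval _ _)
      (isBounded_metricInterval _ _))
  exact ⟨w, hw, h.le⟩

/-- A point that lies almost on a geodesic from `x` to `y` is close to the interval `I(x,y)`. -/
theorem exists_mem_metricInterval_near (hgeo : IsDiscretelyGeodesic X) {β : ℝ} (hβ : 0 ≤ β)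
    (hstable : HasStableIntervals X β) (x z : X) (n : ℕ) :
    ∀ (y : X) (k : ℕ), dist z y = n → dist x z + dist z y ≤ dist x y + k →
      ∃ v ∈ metricInterval x y, dist v z ≤ k * (β + 1) := by
  induction n with
  | zero =>
    intro y k hy _
    have : z = y := by simpa using hy
    subst this
    exact ⟨z, right_mem_metricInterval x z, by rw [dist_self]; positivity⟩
  | succ n ih =>
    intro y k hy hk
    obtain ⟨y', h1, h2⟩ := hgeo.exists_pred hy
    obtain ⟨a, ha⟩ := hgeo.exists_nat_dist x y
    obtain ⟨a', ha'⟩ := hgeo.exists_nat_dist x y'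
    have h3 : dist x y ≤ dist x y' + dist y' y := dist_triangle _ _ _
    push_cast at hy
    -- If `y'` is closer to `x` than `y`, then I(x,y') lies in I(x,y) and nothing is lost. Otherwise
    -- replacing `y` by `y'` lowers the excess `k` by one, and one use of stability, costing `β +
    -- 1`, returns to I(x,y). This happens at most `k` times.
    by_cases hc : a = a' + 1
    · have hc' : dist x y = dist x y' + 1 := by rw [ha, ha', hc]; push_cast; ring
      obtain ⟨v, hv, hvz⟩ := ih y' k h1 (by linarith)
      refine ⟨v, ?_, hvz⟩
      have hv' : dist x v + dist v y' = dist x y' := hv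
      have h4 := dist_triangle v y' y
      have h5 := dist_triangle x v y
      change dist x v + dist v y = dist x y
      linarith
    · have hle : a ≤ a' + 1 := by
        have : (a : ℝ) ≤ a' + 1 := by linarith
        exact_mod_cast this
      have hle' : a ≤ a' := by omega
      have hle'' : dist x y ≤ dist x y' := by rw [ha, ha']; exact_mod_cast hle'
      cases k with
      | zero =>
        have := dist_triangle x z y'
        simp only [Nat.cast_zero] at hk
        linarith
      | succ k =>
        push_cast at hk
        obtain ⟨v, hv, hvz⟩ := ih y' k h1 (by linarith)
        obtain ⟨w, hw, hvw⟩ := hstable.exists_near h2 hv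
        refine ⟨w, hw, ?_⟩
        have := dist_triangle_left w z v
        push_cast
        linarith

/-- If the distance functions of `x` and `x'` differ by a constant near `v`, then `x` and `x'` have
the same cone at `v`. -/
theorem mem_metricInterval_of_sub_eq (hgeo : IsDiscretelyGeodesic X) {β : ℝ}
    (hstable : HasStableIntervals X β) {x x' v : X}
    (h : ∀ w, dist v w ≤ β + 1 → dist x w - dist x v = dist x' w - dist x' v) (n : ℕ) :
    ∀ y, dist v y = n → v ∈ metricInterval x y → v ∈ metricInterval x' y := by
  induction n with
  | zero =>
    intro y hy _
    have : v = y := by simpa using hy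
    subst this
    exact right_mem_metricInterval x' v
  | succ n ih =>
    intro y hy hv
    have hv' : dist x v + dist v y = dist x y := hv
    obtain ⟨y', h1, h2⟩ := hgeo.exists_pred hy
    push_cast at hy
    have hvy' : v ∈ metricInterval x y' := by
      have h3 := dist_triangle x v y'
      have h4 := dist_triangle x y' y
      change dist x v + dist v y' = dist x y'
      linarith
    -- The point `w` of I(x',y) is close enough to `v` for `h` to apply, so the triangle inequality
    -- for `x`, `w`, `y`, where `v` is on a geodesic, turns into the one needed for `x'`.
    obtain ⟨w, hw, hvw⟩ := hstable.exists_near h2 (ih y' h1 hvy')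
    have hw' : dist x' w + dist w y = dist x' y := hw
    have h5 := h w hvw
    have h6 := dist_triangle x w y
    have h7 := dist_triangle x' v y
    change dist x' v + dist v y = dist x' y
    linarith

end Geometry

/-! ### Extremal functions and the finiteness of their sharp pairs -/

section Extremal

variable {X : Type u} [MetricSpace X]

theorem deltaFunctions_nonneg {f : X → ℝ} (hf : f ∈ deltaFunctions X) (x : X) : 0 ≤ f x := by
  have := hf x x
  rw [dist_self] at this
  linarith

theorem extremalFunctions_le_add_dist {f : X → ℝ} (hf : f ∈ extremalFunctions X) (x y : X) :
    f x ≤ f y + dist x y :=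
  InjectiveHull.le_add_dist ⟨f, hf⟩ x y

/-- Otherwise the value at `x` could be lowered by ε/2 inside Δ(X), against minimality. Half of ε is
the right amount since the pair (x,x) is lowered twice. -/
theorem exists_add_lt_of_mem_extremalFunctions {f : X → ℝ} (hf : f ∈ extremalFunctions X) (x : X)
    {ε : ℝ} (hε : 0 < ε) : ∃ y, f x + f y < dist x y + ε := by
  classical
  by_contra! hcon
  have hg : Function.update f x (f x - ε / 2) ∈ deltaFunctions X := by
    intro a b
    by_cases ha : a = x <;> by_cases hb : b = x
    · subst ha; subst hb
      have := hcon b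
      simp only [Function.update_self]
      linarith
    · subst ha
      have := hcon b
      simp only [Function.update_self, Function.update_of_ne hb]
      linarith
    · subst hb
      have := hcon a
      rw [dist_comm] at this
      simp only [Function.update_self, Function.update_of_ne ha]
      linarith
    · simpa [Function.update_of_ne ha, Function.update_of_ne hb] using hf.1 a b
  have hle : Function.update f x (f x - ε / 2) ≤ f := by
    intro a
    by_cases ha : a = x
    · subst ha; simp; linarith
    · simp [Function.update_of_ne ha]
  have h := congrFun (hf.2 _ hg hle) x
  rw [Function.update_self] at h
  linarith

theorem mem_extremalFunctions_of_exists {f : X → ℝ} (hf : f ∈ deltaFunctions X)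
    (h : ∀ x, ∃ y, f x + f y = dist x y) : f ∈ extremalFunctions X := by
  refine ⟨hf, fun g hg hgf => le_antisymm hgf fun x => ?_⟩
  obtain ⟨y, hy⟩ := h x
  have h1 := hg x y
  have h2 := hgf y
  linarith

/-- The pairs at which the inequality `d(x,y) ≤ f x + f y` is sharp. -/
def edgeSet (f : X → ℝ) : Set (X × X) :=
  {p | f p.1 + f p.2 = dist p.1 p.2}

theorem mem_edgeSet {f : X → ℝ} {x y : X} : (x, y) ∈ edgeSet f ↔ f x + f y = dist x y := Iff.rfl

theorem edgeSet_swap {f : X → ℝ} {x y : X} (h : (x, y) ∈ edgeSet f) : (y, x) ∈ edgeSet f := by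
  rw [mem_edgeSet] at h ⊢
  rw [dist_comm, ← h, add_comm]

/-- The combinatorial finiteness properties of the extremal functions of a discretely geodesic space
with stable intervals and finite balls. -/
structure HasFiniteEdgePatterns (X : Type u) [MetricSpace X] : Prop where
  exists_nat_dist : ∀ x y : X, ∃ n : ℕ, dist x y = n
  exists_edge : ∀ f ∈ extremalFunctions X, ∀ x, ∃ y, (x, y) ∈ edgeSet f
  exists_gap : ∀ f ∈ extremalFunctions X, ∃ δ > 0, ∀ x y, f x + f y < dist x y + δ →
    (x, y) ∈ edgeSet f
  finite_edgeSet : ∀ (z : X) (r : ℝ), (edgeSet '' {f | f ∈ extremalFunctions X ∧ f z ≤ r}).Finite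
  exists_finite_rep : ∀ f ∈ extremalFunctions X, ∃ s : Set X, s.Finite ∧ ∀ x, ∃ x' ∈ s,
    ∀ y, (x, y) ∈ edgeSet f → (x', y) ∈ edgeSet f

/-- The horofunction-like type of `x` seen from the ball of radius `r` about `z`. -/
def ballType (z : X) (r : ℝ) (x : X) : Metric.closedBall z r → ℝ :=
  fun w => dist x w - dist x z

theorem finite_range_ballType (hint : ∀ x y : X, ∃ n : ℕ, dist x y = n)
    (hfin : ∀ s : Set X, Bornology.IsBounded s → s.Finite) (z : X) (r : ℝ) :
    (Set.range (ballType z r)).Finite := by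
  have : Finite (Metric.closedBall z r) := (hfin _ Metric.isBounded_closedBall).to_subtype
  have hS : ((fun m : ℤ => (m : ℝ)) '' Set.Icc (-⌈r⌉) ⌈r⌉).Finite := (Set.finite_Icc _ _).image _
  refine (Set.Finite.pi' fun _ : Metric.closedBall z r => hS).subset ?_
  rintro _ ⟨x, rfl⟩ w
  obtain ⟨a, ha⟩ := hint x w
  obtain ⟨b, hb⟩ := hint x z
  have hw : dist w.1 z ≤ r := w.2
  have h1 := dist_triangle x w z
  have h2 := dist_triangle_right x w.1 z
  have h3 := Int.le_ceil r
  refine ⟨(a : ℤ) - b, ⟨?_, ?_⟩, ?_⟩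
  · have : (-⌈r⌉ : ℝ) ≤ (a : ℝ) - b := by linarith
    exact_mod_cast this
  · have : (a : ℝ) - b ≤ ⌈r⌉ := by
      linarith
    exact_mod_cast this
  · simp [ballType, ha, hb]

/-- Suppose `f x + f y` exceeds `d(x,y)` by at most `1`. Then points of the same type as `x` as seen
from a large ball have the same excess. -/
theorem exists_interval_transfer (hgeo : IsDiscretelyGeodesic X) {β : ℝ} (hβ : 0 ≤ β)
    (hstable : HasStableIntervals X β) {f : X → ℝ} (hf : f ∈ extremalFunctions X) {z : X} {k : ℕ}
    (hk : 2 * f z + 1 ≤ k) {x x' y : X}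
    (hx : ballType z ((k + 1) * (β + 1)) x = ballType z ((k + 1) * (β + 1)) x')
    (hxy : f x + f y ≤ dist x y + 1) :
    dist x' y - dist x' z = dist x y - dist x z := by
  obtain ⟨n, hn⟩ := hgeo.exists_nat_dist z y
  have h1 := hf.1 x z
  have h2 := hf.1 z y
  -- Adding `h1`, `h2` and `hxy` shows that `z` has excess at most 2 f z + 1 over d(x,y), hence at
  -- most `k`. So `v` is within k(β + 1) of `z`; the further β + 1 in the radius covers the ball
  -- about `v` on which the types are compared.
  obtain ⟨v, hv, hvz⟩ := exists_mem_metricInterval_near hgeo hβ hstable x z n y k hn (by linarith)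
  have key : ∀ w, dist w z ≤ (k + 1) * (β + 1) → dist x w - dist x z = dist x' w - dist x' z :=
    fun w hw => congrFun hx ⟨w, hw⟩
  have hv0 := key v (by linarith)
  obtain ⟨m, hm⟩ := hgeo.exists_nat_dist v y
  have hv' := mem_metricInterval_of_sub_eq hgeo hstable (x := x) (x' := x') (v := v)
    (fun w hw => by
      have := key w (by have := dist_triangle_left w z v; linarith)
      linarith) m y hm hv
  have e1 : dist x v + dist v y = dist x y := hv
  have e2 : dist x' v + dist v y = dist x' y := hv'
  linarith

/-- A nearly sharp partner y of x gives f x ≈ d(x,y) - f y. The transfer replaces d(x,y) by its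
value for x', and f x' ≥ d(x',y) - f y gives one inequality; the other is symmetric. -/
theorem sub_dist_eq_of_ballType_eq (hgeo : IsDiscretelyGeodesic X) {β : ℝ} (hβ : 0 ≤ β)
    (hstable : HasStableIntervals X β) {f : X → ℝ} (hf : f ∈ extremalFunctions X) {z : X} {k : ℕ}
    (hk : 2 * f z + 1 ≤ k) {x x' : X}
    (hx : ballType z ((k + 1) * (β + 1)) x = ballType z ((k + 1) * (β + 1)) x') :
    f x - dist x z = f x' - dist x' z := by
  have key : ∀ {x x' : X},
      ballType z ((k + 1) * (β + 1)) x = ballType z ((k + 1) * (β + 1)) x' →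
      f x - dist x z ≤ f x' - dist x' z := by
    intro x x' hx
    refine le_of_forall_pos_lt_add fun ε hε => ?_
    obtain ⟨y, hy⟩ := exists_add_lt_of_mem_extremalFunctions hf x (ε := min ε 1) (by positivity)
    have h1 := min_le_left ε 1
    have h2 := min_le_right ε 1
    have h3 := exists_interval_transfer hgeo hβ hstable hf hk hx (y := y) (by linarith)
    have h4 := hf.1 x' y
    linarith
  exact le_antisymm (key hx) (key hx.symm)

theorem edge_of_ballType_eq (hgeo : IsDiscretelyGeodesic X) {β : ℝ} (hβ : 0 ≤ β)
    (hstable : HasStableIntervals X β) {f : X → ℝ} (hf : f ∈ extremalFunctions X) {z : X} {k : ℕ}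
    (hk : 2 * f z + 1 ≤ k) {x x' y : X}
    (hx : ballType z ((k + 1) * (β + 1)) x = ballType z ((k + 1) * (β + 1)) x')
    (hxy : (x, y) ∈ edgeSet f) : (x', y) ∈ edgeSet f := by
  rw [mem_edgeSet] at *
  have h1 := sub_dist_eq_of_ballType_eq hgeo hβ hstable hf hk hx
  have h2 := exists_interval_transfer hgeo hβ hstable hf hk hx (y := y) (by linarith)
  linarith

theorem Set.Finite.exists_pos_lt {s : Set ℝ} (hs : s.Finite) :
    ∃ δ > 0, ∀ a ∈ s, 0 < a → δ ≤ a := by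
  by_cases hne : (s ∩ Set.Ioi 0).Nonempty
  · obtain ⟨m, hm, hmin⟩ := Set.exists_min_image (s ∩ Set.Ioi 0) id
      (hs.subset Set.inter_subset_left) hne
    exact ⟨m, hm.2, fun a ha h0 => hmin a ⟨ha, h0⟩⟩
  · exact ⟨1, one_pos, fun a ha h0 => (hne ⟨a, ha, h0⟩).elim⟩

theorem finite_range_sub_dist (hgeo : IsDiscretelyGeodesic X)
    (hfin : ∀ s : Set X, Bornology.IsBounded s → s.Finite) {β : ℝ} (hβ : 0 ≤ β)
    (hstable : HasStableIntervals X β) {f : X → ℝ} (hf : f ∈ extremalFunctions X) (z : X) :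
    (Set.range fun x => f x - dist x z).Finite := by
  have : Nonempty X := ⟨z⟩
  obtain ⟨k, hk⟩ := exists_nat_ge (2 * f z + 1)
  have hT := finite_range_ballType hgeo.exists_nat_dist hfin z ((k + 1) * (β + 1))
  have : Set.range (fun x => f x - dist x z) =
      (fun t => f (Function.invFun (ballType z ((k + 1) * (β + 1))) t) -
        dist (Function.invFun (ballType z ((k + 1) * (β + 1))) t) z) ''
      Set.range (ballType z ((k + 1) * (β + 1))) := by
    rw [← Set.range_comp]
    congr 1
    ext x
    exact sub_dist_eq_of_ballType_eq hgeo hβ hstable hf hk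
      (Function.invFun_eq (f := ballType z ((k + 1) * (β + 1))) ⟨x, rfl⟩).symm
  rw [this]
  exact hT.image _

/-- The excess f x + f y - d(x,y) is the sum of f x - d(x,z), f y - d(y,z) and the integer d(x,z) +
d(y,z) - d(x,y). The first two take finitely many values, and the integer is at most 1 + 2 f z when
the excess is below 1. So the excess has finitely many values below 1. -/
theorem exists_edgeSet_gap (hgeo : IsDiscretelyGeodesic X)
    (hfin : ∀ s : Set X, Bornology.IsBounded s → s.Finite) {β : ℝ} (hβ : 0 ≤ β)
    (hstable : HasStableIntervals X β) {f : X → ℝ} (hf : f ∈ extremalFunctions X) :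
    ∃ δ > 0, ∀ x y, f x + f y < dist x y + δ → (x, y) ∈ edgeSet f := by
  by_cases hX : Nonempty X
  swap
  · exact ⟨1, one_pos, fun x => (hX ⟨x⟩).elim⟩
  obtain ⟨z⟩ := hX
  have hR := finite_range_sub_dist hgeo hfin hβ hstable hf z
  obtain ⟨N, hN⟩ := exists_nat_ge (1 + 2 * f z)
  have hS : ((fun p : (ℝ × ℝ) × ℕ => p.1.1 + p.1.2 + p.2) ''
      (((Set.range fun x => f x - dist x z) ×ˢ (Set.range fun x => f x - dist x z)) ×ˢ
        Set.Iic N)).Finite := ((hR.prod hR).prod (Set.finite_Iic N)).image _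
  obtain ⟨δ, hδ, hmin⟩ := hS.exists_pos_lt
  refine ⟨min δ 1, by positivity, fun x y hxy => ?_⟩
  have h1 := min_le_left δ 1
  have h2 := min_le_right δ 1
  by_contra hne
  have h0 : 0 < f x + f y - dist x y :=
    sub_pos.2 (lt_of_le_of_ne (hf.1 x y) fun h => hne h.symm)
  obtain ⟨a, ha⟩ := hgeo.exists_nat_dist x z
  obtain ⟨b, hb⟩ := hgeo.exists_nat_dist y z
  obtain ⟨c, hc⟩ := hgeo.exists_nat_dist x y
  have htri : c ≤ a + b := by
    have : (c : ℝ) ≤ a + b := by rw [← ha, ← hb, ← hc]; exact dist_triangle_right _ _ _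
    exact_mod_cast this
  have hcast : ((a + b - c : ℕ) : ℝ) = dist x z + dist y z - dist x y := by
    rw [Nat.cast_sub htri, ha, hb, hc]; push_cast; ring
  have h3 := hf.1 x z
  have h4 := hf.1 y z
  have hle : a + b - c ≤ N := by
    have : ((a + b - c : ℕ) : ℝ) ≤ N := by rw [hcast]; linarith
    exact_mod_cast this
  have := hmin (f x + f y - dist x y)
    ⟨((f x - dist x z, f y - dist y z), a + b - c), ⟨⟨⟨x, rfl⟩, ⟨y, rfl⟩⟩, hle⟩, by
      simp only [hcast]; ring⟩ h0
  linarith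

theorem hasFiniteEdgePatterns (hgeo : IsDiscretelyGeodesic X)
    (hfin : ∀ s : Set X, Bornology.IsBounded s → s.Finite) {β : ℝ} (hβ : 0 ≤ β)
    (hstable : HasStableIntervals X β) : HasFiniteEdgePatterns X where
  exists_nat_dist := hgeo.exists_nat_dist
  exists_edge f hf x := by
    obtain ⟨δ, hδ, h⟩ := exists_edgeSet_gap hgeo hfin hβ hstable hf
    obtain ⟨y, hy⟩ := exists_add_lt_of_mem_extremalFunctions hf x hδ
    exact ⟨y, h x y hy⟩
  exists_gap f hf := exists_edgeSet_gap hgeo hfin hβ hstable hf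
  finite_edgeSet z r := by
    obtain ⟨k, hk⟩ := exists_nat_ge (2 * r + 1)
    -- One radius serves all `f` with f z ≤ r, so each edge set is the preimage under `τ × τ` of a
    -- subset of one finite set.
    set τ := ballType z ((k + 1) * (β + 1)) with hτ
    have hT : (Set.range τ).Finite := finite_range_ballType hgeo.exists_nat_dist hfin z _
    refine (((hT.prod hT).finite_subsets).image fun S => Prod.map τ τ ⁻¹' S).subset ?_
    rintro _ ⟨f, ⟨hf, hfz⟩, rfl⟩
    have hk' : 2 * f z + 1 ≤ k := by linarith
    refine ⟨Prod.map τ τ '' edgeSet f, ?_, ?_⟩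
    · rintro _ ⟨p, -, rfl⟩
      exact ⟨⟨p.1, rfl⟩, ⟨p.2, rfl⟩⟩
    · refine Set.Subset.antisymm ?_ (Set.subset_preimage_image _ _)
      rintro ⟨x, y⟩ ⟨⟨x', y'⟩, h, he⟩
      simp only [Prod.map_apply, Prod.mk.injEq] at he
      have h1 := edge_of_ballType_eq hgeo hβ hstable hf hk' he.1 h
      exact edgeSet_swap (edge_of_ballType_eq hgeo hβ hstable hf hk' he.2 (edgeSet_swap h1))
  exists_finite_rep f hf := by
    by_cases hX : Nonempty X
    swap
    · exact ⟨∅, Set.finite_empty, fun x => (hX ⟨x⟩).elim⟩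
    obtain ⟨z⟩ := hX
    have : Nonempty X := ⟨z⟩
    obtain ⟨k, hk⟩ := exists_nat_ge (2 * f z + 1)
    set τ := ballType z ((k + 1) * (β + 1)) with hτ
    have hT : (Set.range τ).Finite := finite_range_ballType hgeo.exists_nat_dist hfin z _
    refine ⟨Function.invFun τ '' Set.range τ, hT.image _, fun x =>
      ⟨_, ⟨τ x, ⟨x, rfl⟩, rfl⟩, fun y hy => ?_⟩⟩
    exact edge_of_ballType_eq hgeo hβ hstable hf hk (Function.invFun_eq (f := τ) ⟨x, rfl⟩).symm hy

end Extremal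

/-! ### Cells as polytopes, and the polyhedral complex they form -/

section Cells

variable {X : Type u}

/-- The directions that preserve the equations `g x + g y = d(x,y)` over the pairs in `S`. -/
def edgeDirections (S : Set (X × X)) : Submodule ℝ (X → ℝ) where
  carrier := {h | ∀ p ∈ S, h p.1 + h p.2 = 0}
  add_mem' {a b} ha hb p hp := by
    have h1 := ha p hp
    have h2 := hb p hp
    simp only [Pi.add_apply]
    linarith
  zero_mem' p _ := by simp
  smul_mem' c a ha p hp := by
    have h1 := ha p hp
    simp only [Pi.smul_apply, smul_eq_mul]
    rw [← mul_add, h1, mul_zero]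

variable [MetricSpace X]

/-- The cell of `f`: the functions in `Δ(X)` that are sharp wherever `f` is. -/
def hullCell (f : X → ℝ) : Set (X → ℝ) :=
  {g | g ∈ deltaFunctions X ∧ edgeSet f ⊆ edgeSet g}

theorem self_mem_hullCell {f : X → ℝ} (hf : f ∈ extremalFunctions X) : f ∈ hullCell f :=
  ⟨hf.1, subset_rfl⟩

theorem hullCell_anti {f g : X → ℝ} (h : edgeSet f ⊆ edgeSet g) : hullCell g ⊆ hullCell f :=
  fun _ hk => ⟨hk.1, h.trans hk.2⟩

theorem sub_mem_edgeDirections {S : Set (X × X)} {g g' : X → ℝ} (hg : S ⊆ edgeSet g)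
    (hg' : S ⊆ edgeSet g') : g - g' ∈ edgeDirections S := by
  intro p hp
  have h1 : g p.1 + g p.2 = dist p.1 p.2 := hg hp
  have h2 : g' p.1 + g' p.2 = dist p.1 p.2 := hg' hp
  simp only [Pi.sub_apply]
  linarith

theorem convex_deltaFunctions : Convex ℝ (deltaFunctions X) := by
  intro f hf g hg a b ha hb hab x y
  simp only [Pi.add_apply, Pi.smul_apply, smul_eq_mul]
  have h1 := mul_le_mul_of_nonneg_left (hf x y) ha
  have h2 := mul_le_mul_of_nonneg_left (hg x y) hb
  have h3 : dist x y = a * dist x y + b * dist x y := by rw [← add_mul, hab, one_mul]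
  linarith

/-- With positive weights, a combination of two inequalities is sharp only if both are. This
controls faces, intersections and relative interiors of cells. -/
theorem edgeSet_convexCombination {f g : X → ℝ} (hf : f ∈ deltaFunctions X)
    (hg : g ∈ deltaFunctions X) {a b : ℝ} (ha : 0 < a) (hb : 0 < b) (hab : a + b = 1) :
    edgeSet (a • f + b • g) = edgeSet f ∩ edgeSet g := by
  ext ⟨x, y⟩
  have h1 := hf x y
  have h2 := hg x y
  have h3 : dist x y = a * dist x y + b * dist x y := by rw [← add_mul, hab, one_mul]
  simp only [Set.mem_inter_iff, mem_edgeSet, Pi.add_apply, Pi.smul_apply, smul_eq_mul]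
  constructor
  · intro h
    constructor <;> nlinarith
  · rintro ⟨h4, h5⟩
    rw [h3]
    nth_rw 1 [← h4]
    rw [← h5]
    ring

theorem convex_hullCell (f : X → ℝ) : Convex ℝ (hullCell f) := by
  intro g hg h hh a b ha hb hab
  refine ⟨convex_deltaFunctions hg.1 hh.1 ha hb hab, ?_⟩
  rcases ha.eq_or_lt with rfl | ha
  · rw [zero_add] at hab
    simpa [hab] using hh.2
  rcases hb.eq_or_lt with rfl | hb
  · rw [add_zero] at hab
    simpa [hab] using hg.2
  rw [edgeSet_convexCombination hg.1 hh.1 ha hb hab]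
  exact Set.subset_inter hg.2 hh.2

namespace HasFiniteEdgePatterns

variable (hX : HasFiniteEdgePatterns X)

include hX

theorem hullCell_subset {f : X → ℝ} (hf : f ∈ extremalFunctions X) :
    hullCell f ⊆ extremalFunctions X := by
  intro g hg
  refine mem_extremalFunctions_of_exists hg.1 fun x => ?_
  obtain ⟨y, hy⟩ := hX.exists_edge f hf x
  exact ⟨y, hg.2 hy⟩

theorem le_of_mem_hullCell {f : X → ℝ} (hf : f ∈ extremalFunctions X) (x : X) :
    ∃ C, ∀ g ∈ hullCell f, g x ≤ C := by
  obtain ⟨y, hy⟩ := hX.exists_edge f hf x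
  refine ⟨dist x y, fun g hg => ?_⟩
  have h1 : g x + g y = dist x y := hg.2 hy
  have := deltaFunctions_nonneg hg.1 y
  linarith

/-- A direction takes finitely many values, those on a finite set of representatives. -/
theorem exists_finite_values {f : X → ℝ} (hf : f ∈ extremalFunctions X) :
    ∃ s : Set X, s.Finite ∧ ∀ x, ∃ x' ∈ s, ∀ h ∈ edgeDirections (edgeSet f), h x = h x' := by
  obtain ⟨s, hs, H⟩ := hX.exists_finite_rep f hf
  refine ⟨s, hs, fun x => ?_⟩
  obtain ⟨x', hx', he⟩ := H x
  obtain ⟨y, hy⟩ := hX.exists_edge f hf x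
  refine ⟨x', hx', fun h hh => ?_⟩
  have h1 := hh _ hy
  have h2 := hh _ (he y hy)
  simp only at h1 h2
  linarith

theorem exists_abs_le {f : X → ℝ} (hf : f ∈ extremalFunctions X) {h : X → ℝ}
    (hh : h ∈ edgeDirections (edgeSet f)) : ∃ M, ∀ x, |h x| ≤ M := by
  obtain ⟨s, hs, H⟩ := hX.exists_finite_values hf
  obtain ⟨M, hM⟩ := (hs.image fun x => |h x|).bddAbove
  refine ⟨M, fun x => ?_⟩
  obtain ⟨x', hx', e⟩ := H x
  rw [e h hh]
  exact hM ⟨x', hx', rfl⟩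

/-- Every extremal function is in the relative interior of its cell. -/
theorem exists_add_smul_mem_hullCell {f : X → ℝ} (hf : f ∈ extremalFunctions X) {h : X → ℝ}
    (hh : h ∈ edgeDirections (edgeSet f)) :
    ∃ ε > 0, ∀ t : ℝ, |t| ≤ ε → f + t • h ∈ hullCell f := by
  obtain ⟨M, hM⟩ := hX.exists_abs_le hf hh
  obtain ⟨δ, hδ, hgap⟩ := hX.exists_gap f hf
  have hpos : 0 < 2 * (|M| + 1) := by positivity
  -- Each value then moves by at most δ/2, so a pair that is not sharp, having excess at least δ,
  -- stays admissible. The summand 1 keeps the denominator positive.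
  refine ⟨δ / (2 * (|M| + 1)), by positivity, fun t ht => ?_⟩
  have hedge : edgeSet f ⊆ edgeSet (f + t • h) := by
    intro p hp
    have h1 := hh p hp
    have h2 : f p.1 + f p.2 = dist p.1 p.2 := hp
    change f p.1 + t * h p.1 + (f p.2 + t * h p.2) = dist p.1 p.2
    linear_combination h2 + t * h1
  refine ⟨fun x y => ?_, hedge⟩
  by_cases hxy : (x, y) ∈ edgeSet f
  · exact (hedge hxy).ge
  · have h1 : dist x y + δ ≤ f x + f y := by
      by_contra! hlt
      exact hxy (hgap x y hlt)
    have key : ∀ x, |t * h x| ≤ δ / 2 := by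
      intro x
      rw [abs_mul]
      have h2 : |h x| ≤ |M| + 1 := by linarith [hM x, le_abs_self M]
      calc |t| * |h x| ≤ δ / (2 * (|M| + 1)) * (|M| + 1) := by gcongr
        _ = δ / 2 := by field_simp
    have h3 := abs_le.1 (key x)
    have h4 := abs_le.1 (key y)
    change dist x y ≤ f x + t * h x + (f y + t * h y)
    linarith

theorem isCompact_hullCell {f : X → ℝ} (hf : f ∈ extremalFunctions X) :
    IsCompact (hullCell f) := by
  choose C hC using hX.le_of_mem_hullCell hf
  have hcl : IsClosed (hullCell f) := by
    have : hullCell f = (⋂ p : X × X, {g : X → ℝ | dist p.1 p.2 ≤ g p.1 + g p.2}) ∩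
        ⋂ p : edgeSet f, {g : X → ℝ | g p.1.1 + g p.1.2 = dist p.1.1 p.1.2} := by
      ext g
      simp only [hullCell, deltaFunctions, Set.mem_ofPred_eq, Set.mem_inter_iff, Set.mem_iInter,
        Prod.forall, Subtype.forall, Set.subset_def]
      rfl
    rw [this]
    refine IsClosed.inter (isClosed_iInter fun p => ?_) (isClosed_iInter fun p => ?_)
    · exact isClosed_le (by fun_prop) (by fun_prop)
    · exact isClosed_eq (by fun_prop) (by fun_prop)
  refine (isCompact_univ_pi fun x => isCompact_Icc (a := 0) (b := C x)).of_isClosed_subset hcl ?_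
  exact fun g hg x _ => ⟨deltaFunctions_nonneg hg.1 x, hC x g hg⟩

/-- A nonzero direction at `g` would make `g` the midpoint of a segment in the cell. -/
theorem edgeDirections_eq_bot {f g : X → ℝ} (hf : f ∈ extremalFunctions X)
    (hg : g ∈ Set.extremePoints ℝ (hullCell f)) : edgeDirections (edgeSet g) = ⊥ := by
  have hgE := hX.hullCell_subset hf hg.1
  rw [eq_bot_iff]
  intro h hh
  obtain ⟨ε, hε, H⟩ := hX.exists_add_smul_mem_hullCell hgE hh
  have h1 := hullCell_anti hg.1.2 (H ε (abs_of_pos hε).le)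
  have h2 := hullCell_anti hg.1.2 (H (-ε) (by rw [abs_neg, abs_of_pos hε]))
  have h3 : g + ε • h = g := hg.2 h1 h2 ⟨1 / 2, 1 / 2, by norm_num, by norm_num, by norm_num, by
    ext x; simp only [Pi.add_apply, Pi.smul_apply, smul_eq_mul]; ring⟩
  rw [add_eq_left] at h3
  exact (smul_eq_zero.1 h3).resolve_left hε.ne'

theorem finite_edgeSet_hullCell {f : X → ℝ} (hf : f ∈ extremalFunctions X) :
    (edgeSet '' hullCell f).Finite := by
  by_cases hne : Nonempty X
  · obtain ⟨z⟩ := hne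
    obtain ⟨C, hC⟩ := hX.le_of_mem_hullCell hf z
    exact (hX.finite_edgeSet z C).subset
      (Set.image_mono fun g hg => ⟨hX.hullCell_subset hf hg, hC g hg⟩)
  · have : IsEmpty X := not_nonempty_iff.1 hne
    exact Set.toFinite _

theorem finite_extremePoints_hullCell {f : X → ℝ} (hf : f ∈ extremalFunctions X) :
    (Set.extremePoints ℝ (hullCell f)).Finite := by
  refine Set.Finite.of_finite_image (f := edgeSet)
    ((hX.finite_edgeSet_hullCell hf).subset (Set.image_mono (extremePoints_subset (𝕜 := ℝ)))) ?_
  intro g hg g' hg' he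
  have : g - g' ∈ edgeDirections (edgeSet g) :=
    sub_mem_edgeDirections subset_rfl (by rw [he])
  rw [hX.edgeDirections_eq_bot hf hg] at this
  exact sub_eq_zero.1 this

/-- This is Krein–Milman in the product topology; the closure is superfluous because the extreme
points are finite in number. -/
theorem convexHull_extremePoints_hullCell {f : X → ℝ} (hf : f ∈ extremalFunctions X) :
    convexHull ℝ (Set.extremePoints ℝ (hullCell f)) = hullCell f := by
  rw [← ((hX.finite_extremePoints_hullCell hf).isClosed_convexHull ℝ).closure_eq]
  exact closure_convexHull_extremePoints (hX.isCompact_hullCell hf) (convex_hullCell f)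

theorem extremePoints_hullCell_nonempty {f : X → ℝ} (hf : f ∈ extremalFunctions X) :
    (Set.extremePoints ℝ (hullCell f)).Nonempty :=
  (hX.isCompact_hullCell hf).extremePoints_nonempty ⟨f, self_mem_hullCell hf⟩

theorem isPolytope_hullCell {f : X → ℝ} (hf : f ∈ extremalFunctions X) :
    IsPolytope (hullCell f) :=
  ⟨_, hX.finite_extremePoints_hullCell hf, hX.extremePoints_hullCell_nonempty hf,
    (hX.convexHull_extremePoints_hullCell hf).symm⟩

/-- A point `g` of `F` with minimal edge set is relatively interior to `F`. A segment from any point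
of its cell can be prolonged beyond `g`, so extremality puts that point in `F`; conversely,
midpoints with `g` and minimality put `F` in the cell of `g`. -/
theorem exists_eq_hullCell_of_isFaceOf {f : X → ℝ} (hf : f ∈ extremalFunctions X)
    {F : Set (X → ℝ)} (hF : IsFaceOf F (hullCell f)) :
    ∃ g ∈ extremalFunctions X, hullCell g = F := by
  obtain ⟨hne, hconv, hext⟩ := hF
  have hsub := hext.1
  obtain ⟨S, ⟨g, hgF, rfl⟩, hmin⟩ := Set.Finite.exists_minimal
    ((hX.finite_edgeSet_hullCell hf).subset (Set.image_mono hsub)) (hne.image edgeSet)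
  have hgE := hX.hullCell_subset hf (hsub hgF)
  refine ⟨g, hgE, Set.Subset.antisymm ?_ ?_⟩
  · intro h hh
    have hd : g - h ∈ edgeDirections (edgeSet g) := sub_mem_edgeDirections subset_rfl hh.2
    obtain ⟨ε, hε, H⟩ := hX.exists_add_smul_mem_hullCell hgE hd
    have h1 := hullCell_anti (hsub hgF).2 (H ε (abs_of_pos hε).le)
    have h2 := hullCell_anti (hsub hgF).2 hh
    refine hext.2 h2 h1 hgF ⟨ε / (1 + ε), 1 / (1 + ε), by positivity, by positivity, ?_, ?_⟩
    · field_simp; ring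
    · ext x
      simp only [Pi.add_apply, Pi.smul_apply, Pi.sub_apply, smul_eq_mul]
      field_simp
      ring
  · intro h hh
    have hmid := hconv hgF hh (a := 1 / 2) (b := 1 / 2) (by norm_num) (by norm_num) (by norm_num)
    have he := edgeSet_convexCombination (hsub hgF).1 (hsub hh).1 (a := 1 / 2) (b := 1 / 2)
      (by norm_num) (by norm_num) (by norm_num)
    refine ⟨(hsub hh).1, (hmin ⟨_, hmid, rfl⟩ ?_).trans ?_⟩
    · rw [he]; exact Set.inter_subset_left
    · rw [he]; exact Set.inter_subset_right

omit hX in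
theorem isFaceOf_inter_hullCell {f f' : X → ℝ} (h : (hullCell f ∩ hullCell f').Nonempty) :
    IsFaceOf (hullCell f ∩ hullCell f') (hullCell f) := by
  refine ⟨h, (convex_hullCell f).inter (convex_hullCell f'), Set.inter_subset_left, ?_⟩
  rintro g hg k hk m hm ⟨a, b, ha, hb, hab, rfl⟩
  have := hm.2.2
  rw [edgeSet_convexCombination hg.1 hk.1 ha hb hab] at this
  exact ⟨hg, hg.1, this.trans Set.inter_subset_left⟩

theorem isPolyhedralComplex :
    IsPolyhedralComplex (hullCell '' extremalFunctions X) (extremalFunctions X) where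
  isPolytope := by
    rintro _ ⟨f, hf, rfl⟩
    exact hX.isPolytope_hullCell hf
  face_mem := by
    rintro _ ⟨f, hf, rfl⟩ F hF
    exact hX.exists_eq_hullCell_of_isFaceOf hf hF
  inter_face := by
    rintro _ ⟨f, hf, rfl⟩ _ ⟨f', hf', rfl⟩ h
    refine ⟨isFaceOf_inter_hullCell h, ?_⟩
    rw [Set.inter_comm] at h ⊢
    exact isFaceOf_inter_hullCell h
  sUnion_eq := by
    refine Set.Subset.antisymm ?_ fun f hf => ⟨_, ⟨f, hf, rfl⟩, self_mem_hullCell hf⟩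
    rintro g ⟨_, ⟨f, hf, rfl⟩, hg⟩
    exact hX.hullCell_subset hf hg

/-- Only finitely many cells come near the base point `z`. -/
theorem finite_hullCell_meeting (z : X) (r : ℝ) :
    {c ∈ hullCell '' extremalFunctions X | ∃ g ∈ c, g z ≤ r}.Finite := by
  refine ((hX.finite_edgeSet z (r + 1)).image
    fun S => {g | g ∈ deltaFunctions X ∧ S ⊆ edgeSet g}).subset ?_
  rintro _ ⟨⟨f, hf, rfl⟩, g, hg, hgz⟩
  have hfz := deltaFunctions_nonneg hf.1 z
  have hgz0 := deltaFunctions_nonneg hg.1 z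
  -- Moving `g` slightly towards `f` gives a point with the edge set of `f` whose value at `z` is at
  -- most r + 1. The choice of `t` ensures t f z ≤ 1 and 0 < t < 1, even if f z = 0.
  set t : ℝ := 1 / (f z + 2) with ht
  have ht0 : 0 < t := by positivity
  have ht1 : 0 < 1 - t := by
    rw [ht, sub_pos, div_lt_one (by positivity)]
    linarith
  have htf : t * f z ≤ 1 := by
    rw [ht, one_div, inv_mul_le_iff₀ (by positivity)]
    linarith
  have he : edgeSet (t • f + (1 - t) • g) = edgeSet f := by
    rw [edgeSet_convexCombination hf.1 hg.1 ht0 ht1 (by ring), Set.inter_eq_left]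
    exact hg.2
  refine ⟨edgeSet f, ⟨t • f + (1 - t) • g, ⟨?_, ?_⟩, he⟩, rfl⟩
  · exact hX.hullCell_subset hf (convex_hullCell f (self_mem_hullCell hf) hg ht0.le ht1.le
      (by ring))
  · simp only [Pi.add_apply, Pi.smul_apply, smul_eq_mul]
    nlinarith

end HasFiniteEdgePatterns

end Cells

/-! ### Coordinates, size and vertices of a cell -/

section Coordinates

variable {X : Type u}

/-- If the coordinate functions on `edgeDirections S` are finite in number, then up to sign the
nonzero ones form a basis of the dual space. -/
theorem exists_edgeDirections_coordinates (S : Set (X × X)) {s : Set X} (hs : s.Finite)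
    (H : ∀ x, ∃ x' ∈ s, ∀ h ∈ edgeDirections S, h x = h x') :
    ∃ ρ : Fin (Module.finrank ℝ (edgeDirections S)) → X, ∀ y,
      (∀ h ∈ edgeDirections S, h y = 0) ∨ ∃ i, (∀ h ∈ edgeDirections S, h y = h (ρ i)) ∨
        ∀ h ∈ edgeDirections S, h y = - h (ρ i) := by
  classical
  let N : Set X := {x | ∃ h ∈ edgeDirections S, h x ≠ 0}
  let E : X → X → Prop := fun x y => ∀ h ∈ edgeDirections S, h x = h y
  let E' : X → X → Prop := fun x y => ∀ h ∈ edgeDirections S, h x = - h y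
  let st : Setoid N :=
    { r := fun x y => E x y ∨ E' x y
      iseqv :=
        { refl := fun x => Or.inl fun h _ => rfl
          symm := by
            rintro x y (h | h)
            · exact Or.inl fun k hk => (h k hk).symm
            · exact Or.inr fun k hk => by rw [h k hk, neg_neg]
          trans := by
            rintro x y z (h | h) (h' | h')
            · exact Or.inl fun k hk => (h k hk).trans (h' k hk)
            · exact Or.inr fun k hk => (h k hk).trans (h' k hk)
            · exact Or.inr fun k hk => by rw [h k hk, h' k hk]
            · exact Or.inl fun k hk => by rw [h k hk, h' k hk, neg_neg] } }
  have hfinite : Finite (Quotient st) := by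
    have : Finite {x : N // x.1 ∈ s} := by
      have := hs.to_subtype
      exact Finite.of_injective (fun x => (⟨x.1.1, x.2⟩ : s)) fun a b hab => by
        simpa [Subtype.ext_iff] using hab
    refine Finite.of_surjective (fun x : {x : N // x.1 ∈ s} => (Quotient.mk st x.1)) ?_
    intro q
    obtain ⟨⟨x, h0, hh0, hne⟩, rfl⟩ := Quotient.exists_rep q
    obtain ⟨x', hx', e⟩ := H x
    refine ⟨⟨⟨x', h0, hh0, by rwa [← e h0 hh0]⟩, hx'⟩, Quotient.sound ?_⟩
    exact Or.inl fun k hk => (e k hk).symm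
  let L : edgeDirections S →ₗ[ℝ] (Quotient st → ℝ) :=
    (LinearMap.funLeft ℝ ℝ fun q : Quotient st => q.out.1) ∘ₗ (edgeDirections S).subtype
  have hout : ∀ y : N, E y (Quotient.mk st y).out ∨ E' y (Quotient.mk st y).out := fun y =>
    st.symm (Quotient.mk_out (s := st) y)
  have hinj : Function.Injective L := by
    rw [injective_iff_map_eq_zero]
    rintro ⟨h, hh⟩ h0
    refine Subtype.ext (funext fun y => ?_)
    by_contra hy
    have hq : h (Quotient.mk st ⟨y, h, hh, hy⟩).out = 0 := congrFun h0 _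
    rcases hout ⟨y, h, hh, hy⟩ with e | e
    · exact hy ((e h hh).trans hq)
    · exact hy ((e h hh).trans (by rw [hq, neg_zero]; rfl))
  have hsurj : Function.Surjective L := by
    intro c
    -- Values on the classes can be prescribed freely: a pair in `S` has both ends in one class or
    -- both outside `N`. In the former case exactly one end agrees with the representative, and the
    -- other gets the opposite sign.
    let k : X → ℝ := fun y => if hy : y ∈ N then
      (if E y (Quotient.mk st ⟨y, hy⟩).out then c (Quotient.mk st ⟨y, hy⟩)
        else - c (Quotient.mk st ⟨y, hy⟩)) else 0
    have hk : k ∈ edgeDirections S := by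
      rintro ⟨y, y'⟩ hp
      have hneg : ∀ h ∈ edgeDirections S, h y = - h y' := fun h hh =>
        eq_neg_of_add_eq_zero_left (hh _ hp)
      by_cases hy : y ∈ N
      · have hy' : y' ∈ N := by
          obtain ⟨h, hh, hne⟩ := hy
          exact ⟨h, hh, fun h0 => hne (by rw [hneg h hh, h0, neg_zero])⟩
        have hq : Quotient.mk st ⟨y, hy⟩ = Quotient.mk st ⟨y', hy'⟩ :=
          Quotient.sound (Or.inr hneg)
        have hiff : E y (Quotient.mk st ⟨y', hy'⟩).out ↔ ¬ E y' (Quotient.mk st ⟨y', hy'⟩).out := by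
          constructor
          · intro e e'
            obtain ⟨h, hh, hne⟩ := hy
            have h1 := e h hh
            have h2 := e' h hh
            have h3 := hneg h hh
            exact hne (by linarith)
          · intro e'
            rcases hout ⟨y', hy'⟩ with e | e
            · exact (e' e).elim
            · intro h hh
              rw [hneg h hh, e h hh, neg_neg]
        simp only [k, dif_pos hy, dif_pos hy', hq, hiff]
        split_ifs <;> simp
      · have hy' : y' ∉ N := by
          rintro ⟨h, hh, hne⟩
          exact hy ⟨h, hh, fun h0 => hne (by rw [← neg_eq_zero, ← hneg h hh, h0])⟩
        simp only [k, dif_neg hy, dif_neg hy', add_zero]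
    refine ⟨⟨k, hk⟩, funext fun q => ?_⟩
    change k q.out = c q
    have h1 : k q.out.1 = if E q.out (Quotient.mk st q.out).out then c (Quotient.mk st q.out)
      else - c (Quotient.mk st q.out) := dif_pos q.out.2
    rw [h1, Quotient.out_eq, if_pos fun _ _ => rfl]
  have hcard : Nat.card (Quotient st) = Module.finrank ℝ (edgeDirections S) := by
    have := Fintype.ofFinite (Quotient st)
    rw [(LinearEquiv.ofBijective L ⟨hinj, hsurj⟩).finrank_eq, Module.finrank_fintype_fun_eq_card,
      Nat.card_eq_fintype_card]
  let e := Finite.equivFinOfCardEq hcard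
  refine ⟨fun i => (e.symm i).out.1, fun y => ?_⟩
  by_cases hy : y ∈ N
  · refine Or.inr ⟨e (Quotient.mk st ⟨y, hy⟩), ?_⟩
    simp only [Equiv.symm_apply_apply]
    exact hout ⟨y, hy⟩
  · refine Or.inl fun h hh => ?_
    by_contra h0
    exact hy ⟨h, hh, h0⟩

/-- A real sequence with steps of size at most `2` cannot move far within a small finite set. -/
theorem sub_le_two_mul_card {u : ℕ → ℝ} {m : ℕ} {S : Finset ℝ}
    (hstep : ∀ k < m, u (k + 1) ≤ u k + 2) (hS : ∀ k ≤ m, u k ∈ S) :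
    u m - u 0 ≤ 2 * S.card := by
  classical
  by_contra! hlt
  -- Cut the range above `u 0` into windows of length 2. At the first time the sequence reaches the
  -- bottom of a window it lies inside it, as steps are at most 2. So there are `S.card + 1`
  -- distinct values in `S`.
  have key : ∀ j ∈ Finset.range (S.card + 1), ∃ k ≤ m, u 0 + 2 * j ≤ u k ∧ u k < u 0 + 2 * j + 2 := by
    intro j hj
    have hj' : (j : ℝ) ≤ S.card := by exact_mod_cast Nat.lt_succ_iff.1 (Finset.mem_range.1 hj)
    have hex : ∃ k, u 0 + 2 * j ≤ u k := ⟨m, by linarith⟩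
    have hfm : Nat.find hex ≤ m := Nat.find_min' hex (by linarith)
    refine ⟨Nat.find hex, hfm, Nat.find_spec hex, ?_⟩
    rcases h : Nat.find hex with _ | k
    · have : (0 : ℝ) ≤ j := Nat.cast_nonneg j
      linarith
    · have h1 := Nat.find_min hex (m := k) (by omega)
      have h2 := hstep k (by omega)
      linarith
  choose! k hkm hk1 hk2 using key
  have := Finset.card_le_card_of_injOn (s := Finset.range (S.card + 1)) (t := S) (fun j => u (k j))
    (fun j hj => hS _ (hkm j hj)) (by
      intro i hi j hj hij
      simp only at hij
      have h1 := hk1 i hi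
      have h2 := hk2 i hi
      have h3 := hk1 j hj
      have h4 := hk2 j hj
      have h5 : (i : ℝ) < j + 1 := by linarith
      have h6 : (j : ℝ) < i + 1 := by linarith
      have h7 : i < j + 1 := by exact_mod_cast h5
      have h8 : j < i + 1 := by exact_mod_cast h6
      omega)
  rw [Finset.card_range] at this
  omega

/-- The points of `ℝⁿ` with half-integral coordinates of absolute value at most `2n + 1`. -/
def halfIntegerGrid (n : ℕ) : Set (Fin n → ℝ) :=
  {a | ∀ i, (∃ m : ℤ, a i = m / 2) ∧ |a i| ≤ 2 * n + 1}

theorem finite_halfIntegerGrid (n : ℕ) : (halfIntegerGrid n).Finite := by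
  have hS : ((fun m : ℤ => (m : ℝ) / 2) '' Set.Icc (-(4 * n + 2)) (4 * n + 2)).Finite :=
    (Set.finite_Icc _ _).image _
  refine (Set.Finite.pi' fun _ : Fin n => hS).subset fun a ha i => ?_
  obtain ⟨⟨m, hm⟩, hb⟩ := ha i
  rw [hm] at hb
  have hb' := abs_le.1 hb
  refine ⟨m, ⟨?_, ?_⟩, hm.symm⟩
  · have : (-(4 * n + 2) : ℝ) ≤ m := by linarith
    exact_mod_cast this
  · have : (m : ℝ) ≤ 4 * n + 2 := by linarith
    exact_mod_cast this

variable [MetricSpace X]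

namespace HasFiniteEdgePatterns

variable (hX : HasFiniteEdgePatterns X)

include hX

theorem vectorSpan_hullCell {f : X → ℝ} (hf : f ∈ extremalFunctions X) :
    vectorSpan ℝ (hullCell f) = edgeDirections (edgeSet f) := by
  refine le_antisymm ?_ fun h hh => ?_
  · rw [vectorSpan_def, Submodule.span_le]
    rintro _ ⟨g, hg, g', hg', rfl⟩
    exact sub_mem_edgeDirections hg.2 hg'.2
  · obtain ⟨ε, hε, H⟩ := hX.exists_add_smul_mem_hullCell hf hh
    have h1 := vsub_mem_vectorSpan ℝ (H ε (abs_of_pos hε).le) (self_mem_hullCell hf)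
    rw [vsub_eq_sub, add_sub_cancel_left] at h1
    exact (Submodule.smul_mem_iff _ hε.ne').1 h1

theorem exists_coordinates {f : X → ℝ} (hf : f ∈ extremalFunctions X) :
    ∃ ρ : Fin (polytopeDim (hullCell f)) → X, ∀ y,
      (∀ h ∈ edgeDirections (edgeSet f), h y = 0) ∨
        ∃ i, (∀ h ∈ edgeDirections (edgeSet f), h y = h (ρ i)) ∨
          ∀ h ∈ edgeDirections (edgeSet f), h y = - h (ρ i) := by
  obtain ⟨s, hs, H⟩ := hX.exists_finite_values hf
  rw [polytopeDim, hX.vectorSpan_hullCell hf]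
  exact exists_edgeDirections_coordinates _ hs H

/-- Along a geodesic from a sharp partner y to x, the difference g - g' rises by at most 2 per step,
both functions being 1-Lipschitz, and takes at most 2n + 1 values: 0 and ± the n coordinates. Since
it has opposite values at x and y, its total rise is twice its value at x. -/
theorem sub_le_of_mem_hullCell (hgeo : IsDiscretelyGeodesic X) {f : X → ℝ}
    (hf : f ∈ extremalFunctions X) {g g' : X → ℝ} (hg : g ∈ hullCell f) (hg' : g' ∈ hullCell f)
    (x : X) : g x - g' x ≤ 2 * polytopeDim (hullCell f) + 1 := by
  classical
  obtain ⟨ρ, hρ⟩ := hX.exists_coordinates hf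
  obtain ⟨y, hxy⟩ := hX.exists_edge f hf x
  have hd := sub_mem_edgeDirections hg.2 hg'.2
  have hopp : (g - g') x + (g - g') y = 0 := hd _ hxy
  obtain ⟨m, -, γ, hγ, h0, hl⟩ := hgeo y x
  have hgE := hX.hullCell_subset hf hg
  have hgE' := hX.hullCell_subset hf hg'
  let S : Finset ℝ := insert 0 (Finset.univ.image (fun i => (g - g') (ρ i)) ∪
    Finset.univ.image (fun i => -(g - g') (ρ i)))
  have hcard : S.card ≤ 2 * polytopeDim (hullCell f) + 1 := by
    refine (Finset.card_insert_le _ _).trans (Nat.succ_le_succ ?_)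
    refine (Finset.card_union_le _ _).trans ?_
    rw [two_mul]
    refine Nat.add_le_add ?_ ?_ <;>
    exact Finset.card_image_le.trans (by simp)
  have hS : ∀ v, (g - g') v ∈ S := by
    intro v
    rcases hρ v with h | ⟨i, h | h⟩
    · rw [h _ hd]
      exact Finset.mem_insert_self _ _
    · rw [h _ hd]
      exact Finset.mem_insert_of_mem (Finset.mem_union_left _
        (Finset.mem_image_of_mem _ (Finset.mem_univ i)))
    · rw [h _ hd]
      exact Finset.mem_insert_of_mem (Finset.mem_union_right _
        (Finset.mem_image_of_mem _ (Finset.mem_univ i)))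
  -- `Fin.ofNat` extends the geodesic to all of ℕ; only indices up to `m`, where it changes nothing,
  -- matter.
  have key := sub_le_two_mul_card (u := fun k => (g - g') (γ (Fin.ofNat (m + 1) k))) (m := m)
    (S := S) (fun k hk => by
      have e : dist (γ (Fin.ofNat (m + 1) (k + 1))) (γ (Fin.ofNat (m + 1) k)) = 1 := by
        rw [hγ]
        simp [Fin.ofNat, Nat.mod_eq_of_lt (show k + 1 < m + 1 by omega),
          Nat.mod_eq_of_lt (show k < m + 1 by omega)]
      have h1 := extremalFunctions_le_add_dist hgE (γ (Fin.ofNat (m + 1) (k + 1)))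
        (γ (Fin.ofNat (m + 1) k))
      have h2 := extremalFunctions_le_add_dist hgE' (γ (Fin.ofNat (m + 1) k))
        (γ (Fin.ofNat (m + 1) (k + 1)))
      rw [dist_comm] at h2
      simp only [Pi.sub_apply]
      linarith) (fun k _ => hS _)
  have hm : Fin.ofNat (m + 1) m = Fin.last m := by ext; simp [Fin.ofNat]
  have hz : Fin.ofNat (m + 1) 0 = 0 := rfl
  simp only [hm, hz, h0, hl] at key
  have hcard' : (S.card : ℝ) ≤ 2 * polytopeDim (hullCell f) + 1 := by exact_mod_cast hcard
  simp only [Pi.sub_apply] at hopp key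
  linarith

/-- Since g x + g y is an integer on each edge, sin(2πg) changes sign across edges and so is a
direction at `g`. A vertex has no nonzero direction, so 2g is integral. -/
theorem exists_eq_half_of_mem_extremePoints {f g : X → ℝ} (hf : f ∈ extremalFunctions X)
    (hg : g ∈ Set.extremePoints ℝ (hullCell f)) (x : X) : ∃ m : ℤ, g x = m / 2 := by
  have hh : (fun x => Real.sin (2 * Real.pi * g x)) ∈ edgeDirections (edgeSet g) := by
    rintro ⟨x, y⟩ hxy
    obtain ⟨n, hn⟩ := hX.exists_nat_dist x y
    have h1 : 2 * Real.pi * g y = n * (2 * Real.pi) - 2 * Real.pi * g x := by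
      have h2 : g x + g y = n := hn ▸ hxy
      linear_combination 2 * Real.pi * h2
    simp only [h1, Real.sin_nat_mul_two_pi_sub, add_neg_cancel]
  rw [hX.edgeDirections_eq_bot hf hg] at hh
  obtain ⟨m, hm⟩ := Real.sin_eq_zero_iff.1 (congrFun hh x)
  refine ⟨m, ?_⟩
  have := Real.pi_pos
  field_simp
  refine mul_right_cancel₀ this.ne' ?_
  linarith

theorem exists_isometryEquiv_convexHull [Nonempty X] (hgeo : IsDiscretelyGeodesic X) {f : X → ℝ}
    (hf : f ∈ extremalFunctions X) {n : ℕ} (hn : polytopeDim (hullCell f) = n) :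
    ∃ K ⊆ halfIntegerGrid n, K.Nonempty ∧
      Nonempty ((InjectiveHull.trace (hullCell f) : Set (InjectiveHull X)) ≃ᵢ convexHull ℝ K) := by
  subst hn
  obtain ⟨ρ, hρ⟩ := hX.exists_coordinates hf
  obtain ⟨q, hq⟩ := hX.extremePoints_hullCell_nonempty hf
  -- Subtracting the vertex `q` puts all vertices in one grid: half-integrality survives, and
  -- coordinates become differences within the cell.
  let φ : (X → ℝ) →ᵃ[ℝ] (Fin (polytopeDim (hullCell f)) → ℝ) :=
    (LinearMap.funLeft ℝ ℝ ρ).toAffineMap - AffineMap.const ℝ (X → ℝ) (q ∘ ρ)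
  have hφ : ∀ g i, φ g i = g (ρ i) - q (ρ i) := fun g i => rfl
  refine ⟨φ '' Set.extremePoints ℝ (hullCell f), ?_, ⟨_, q, hq, rfl⟩, ?_⟩
  · rintro _ ⟨g, hg, rfl⟩ i
    rw [hφ]
    obtain ⟨a, ha⟩ := hX.exists_eq_half_of_mem_extremePoints hf hg (ρ i)
    obtain ⟨b, hb⟩ := hX.exists_eq_half_of_mem_extremePoints hf hq (ρ i)
    refine ⟨⟨a - b, by rw [ha, hb]; push_cast; ring⟩, abs_le.2 ⟨?_, ?_⟩⟩
    · linarith [hX.sub_le_of_mem_hullCell hgeo hf hq.1 hg.1 (ρ i)]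
    · exact hX.sub_le_of_mem_hullCell hgeo hf hg.1 hq.1 (ρ i)
  · let ψ : (InjectiveHull.trace (hullCell f) : Set (InjectiveHull X)) →
        (Fin (polytopeDim (hullCell f)) → ℝ) := fun g => φ g.1.1
    have hdist : ∀ g g' i, dist (ψ g i) (ψ g' i) = |g.1.1 (ρ i) - g'.1.1 (ρ i)| := fun g g' i => by
      rw [← Real.dist_eq]
      exact dist_sub_right (g.1.1 (ρ i)) (g'.1.1 (ρ i)) (q (ρ i))
    have hψ : Isometry ψ := by
      refine Isometry.of_dist_eq fun g g' => le_antisymm ?_ ?_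
      · refine (dist_pi_le_iff dist_nonneg).2 fun i => ?_
        rw [hdist]
        exact le_ciSup (InjectiveHull.bddAbove_abs_sub g.1 g'.1) (ρ i)
      · refine ciSup_le fun x => ?_
        have hd := sub_mem_edgeDirections g.2.2 g'.2.2
        have hle : ∀ i, |(g.1.1 - g'.1.1) (ρ i)| ≤ dist (ψ g) (ψ g') :=
          fun i => (hdist g g' i).symm.trans_le (dist_le_pi_dist (ψ g) (ψ g') i)
        change |(g.1.1 - g'.1.1) x| ≤ _
        rcases hρ x with h | ⟨i, h | h⟩
        · rw [h _ hd, abs_zero]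
          exact dist_nonneg
        · rw [h _ hd]
          exact hle i
        · rw [h _ hd, abs_neg]
          exact hle i
    have hrange : Set.range ψ = convexHull ℝ (φ '' Set.extremePoints ℝ (hullCell f)) := by
      rw [← AffineMap.image_convexHull, hX.convexHull_extremePoints_hullCell hf]
      ext a
      constructor
      · rintro ⟨g, rfl⟩
        exact ⟨g.1.1, g.2, rfl⟩
      · rintro ⟨g, hg, rfl⟩
        exact ⟨⟨⟨g, hX.hullCell_subset hf hg⟩, hg⟩, rfl⟩
    rw [← hrange]
    exact ⟨hψ.isometryEquivOnRange⟩

end HasFiniteEdgePatterns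

end Coordinates

/-! ### Injectivity of cells by averaging extremal Lipschitz extensions -/

section Injective

/-- The mean of the least and the greatest `1`-Lipschitz extension of a real function. -/
noncomputable def meanExtension {B : Type w} [MetricSpace B] {A : Set B} (φ : A → ℝ) (b : B) : ℝ :=
  ((⨆ a : A, (φ a - dist a.1 b)) + ⨅ a : A, (φ a + dist a.1 b)) / 2

variable {B : Type w} [MetricSpace B] {A : Set B}

theorem bddAbove_range_sub_dist {φ : A → ℝ} (hφ : ∀ a a', φ a ≤ φ a' + dist a.1 a'.1) (b : B) :
    BddAbove (Set.range fun a : A => φ a - dist a.1 b) := by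
  by_cases hA : Nonempty A
  · obtain ⟨a₀⟩ := hA
    refine ⟨φ a₀ + dist a₀.1 b, ?_⟩
    rintro _ ⟨a, rfl⟩
    have h1 := hφ a a₀
    have h2 := dist_triangle_right a.1 a₀.1 b
    simp only
    linarith
  · have := not_nonempty_iff.1 hA
    exact (Set.toFinite _).bddAbove

theorem bddBelow_range_add_dist {φ : A → ℝ} (hφ : ∀ a a', φ a ≤ φ a' + dist a.1 a'.1) (b : B) :
    BddBelow (Set.range fun a : A => φ a + dist a.1 b) := by
  by_cases hA : Nonempty A
  · obtain ⟨a₀⟩ := hA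
    refine ⟨φ a₀ - dist a₀.1 b, ?_⟩
    rintro _ ⟨a, rfl⟩
    have h1 := hφ a₀ a
    have h2 := dist_triangle_right a₀.1 a.1 b
    simp only
    linarith
  · have := not_nonempty_iff.1 hA
    exact (Set.toFinite _).bddBelow

theorem meanExtension_coe {φ : A → ℝ} (hφ : ∀ a a', φ a ≤ φ a' + dist a.1 a'.1) (a₀ : A) :
    meanExtension φ a₀.1 = φ a₀ := by
  have : Nonempty A := ⟨a₀⟩
  have h1 : ⨆ a : A, (φ a - dist a.1 a₀.1) = φ a₀ := by
    refine le_antisymm (ciSup_le fun a => by linarith [hφ a a₀]) ?_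
    simpa using le_ciSup (bddAbove_range_sub_dist hφ a₀.1) a₀
  have h2 : ⨅ a : A, (φ a + dist a.1 a₀.1) = φ a₀ := by
    refine le_antisymm ?_ (le_ciInf fun a => by
      have := hφ a₀ a
      rwa [dist_comm] at this)
    simpa using ciInf_le (bddBelow_range_add_dist hφ a₀.1) a₀
  rw [meanExtension, h1, h2]
  ring

theorem meanExtension_le_add_dist [Nonempty A] {φ : A → ℝ}
    (hφ : ∀ a a', φ a ≤ φ a' + dist a.1 a'.1) (b b' : B) :
    meanExtension φ b ≤ meanExtension φ b' + dist b b' := by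
  have h1 : ⨆ a : A, (φ a - dist a.1 b) ≤ (⨆ a : A, (φ a - dist a.1 b')) + dist b b' := by
    refine ciSup_le fun a => ?_
    have h3 := le_ciSup (bddAbove_range_sub_dist hφ b') a
    have h4 := dist_triangle a.1 b b'
    linarith
  have h2 : (⨅ a : A, (φ a + dist a.1 b)) - dist b b' ≤ ⨅ a : A, (φ a + dist a.1 b') := by
    refine le_ciInf fun a => ?_
    have h3 := ciInf_le (bddBelow_range_add_dist hφ b) a
    have h4 := dist_triangle_right a.1 b b'
    linarith
  simp only [meanExtension]
  linarith

/-- Pairing the least extension of one function with the greatest extension of the other cancels the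
distances. The mean averages both pairings, so it keeps lower and upper bounds alike, whereas the
least extensions alone can violate lower bounds and the greatest upper ones. -/
theorem le_meanExtension_add [Nonempty A] {φ ψ : A → ℝ}
    (hφ : ∀ a a', φ a ≤ φ a' + dist a.1 a'.1) (hψ : ∀ a a', ψ a ≤ ψ a' + dist a.1 a'.1)
    {c : ℝ} (hc : ∀ a, c ≤ φ a + ψ a) (b : B) :
    c ≤ meanExtension φ b + meanExtension ψ b := by
  have key : ∀ {φ ψ : A → ℝ}, (∀ a a', φ a ≤ φ a' + dist a.1 a'.1) → (∀ a, c ≤ φ a + ψ a) →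
      c ≤ (⨆ a : A, (φ a - dist a.1 b)) + ⨅ a : A, (ψ a + dist a.1 b) := by
    intro φ ψ hφ hc
    rw [← sub_le_iff_le_add']
    refine le_ciInf fun a => ?_
    have h3 := le_ciSup (bddAbove_range_sub_dist hφ b) a
    have h4 := hc a
    linarith
  have h1 := key hφ hc
  have h2 := key hψ (φ := ψ) (ψ := φ) fun a => by rw [add_comm]; exact hc a
  simp only [meanExtension]
  linarith

theorem meanExtension_add_le [Nonempty A] {φ ψ : A → ℝ}
    (hφ : ∀ a a', φ a ≤ φ a' + dist a.1 a'.1) (hψ : ∀ a a', ψ a ≤ ψ a' + dist a.1 a'.1)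
    {c : ℝ} (hc : ∀ a, φ a + ψ a ≤ c) (b : B) :
    meanExtension φ b + meanExtension ψ b ≤ c := by
  have key : ∀ {φ ψ : A → ℝ}, (∀ a a', ψ a ≤ ψ a' + dist a.1 a'.1) → (∀ a, φ a + ψ a ≤ c) →
      (⨆ a : A, (φ a - dist a.1 b)) + (⨅ a : A, (ψ a + dist a.1 b)) ≤ c := by
    intro φ ψ hψ hc
    rw [← le_sub_iff_add_le]
    refine ciSup_le fun a => ?_
    have h3 := ciInf_le (bddBelow_range_add_dist hψ b) a
    have h4 := hc a
    linarith
  have h1 := key hψ hc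
  have h2 := key hφ (φ := ψ) (ψ := φ) fun a => by rw [add_comm]; exact hc a
  simp only [meanExtension]
  linarith

theorem IsInjectiveMetricSpace.of_isometryEquiv {Y Y' : Type*} [MetricSpace Y] [MetricSpace Y']
    (e : Y ≃ᵢ Y') (hY : IsInjectiveMetricSpace.{_, w} Y) : IsInjectiveMetricSpace.{_, w} Y' := by
  intro B _ A f hf
  obtain ⟨g, hg, hgf⟩ := hY B A (e.symm ∘ f) (by simpa using e.symm.isometry.lipschitz.comp hf)
  refine ⟨e ∘ g, by simpa using e.isometry.lipschitz.comp hg, fun a => ?_⟩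
  simp [hgf a]

/-- A cell is defined by inequalities and equations for sums of two values, all of which survive
extending each coordinate by `meanExtension`. -/
theorem HasFiniteEdgePatterns.isInjectiveMetricSpace_trace {X : Type u} [MetricSpace X]
    [Nonempty X] (hX : HasFiniteEdgePatterns X) {f : X → ℝ} (hf : f ∈ extremalFunctions X) :
    IsInjectiveMetricSpace.{u, w} (InjectiveHull.trace (hullCell f) : Set (InjectiveHull X)) := by
  intro B _ A F hF
  by_cases hA : Nonempty A
  swap
  · exact ⟨fun _ => ⟨⟨f, hf⟩, self_mem_hullCell hf⟩, LipschitzWith.const' _,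
      fun a => (hA ⟨a⟩).elim⟩
  have hlip : ∀ x (a a' : A), (F a).1.1 x ≤ (F a').1.1 x + dist a.1 a'.1 := by
    intro x a a'
    have h1 : dist (F a).1 (F a').1 ≤ dist a a' := hF.dist_le_mul a a' |>.trans_eq (by simp)
    have h2 := (le_abs_self _).trans (le_ciSup (InjectiveHull.bddAbove_abs_sub (F a).1 (F a').1) x)
    have h3 : dist a a' = dist a.1 a'.1 := rfl
    have h4 : (F a).1.1 x - (F a').1.1 x ≤ dist (F a).1 (F a').1 := h2
    linarith
  have hmem : ∀ b, (fun x => meanExtension (fun a => (F a).1.1 x) b) ∈ hullCell f := by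
    refine fun b => ⟨fun x y => ?_, fun p hp => le_antisymm ?_ ?_⟩
    · exact le_meanExtension_add (hlip x) (hlip y) (fun a => (F a).2.1 x y) b
    · exact meanExtension_add_le (hlip p.1) (hlip p.2) (fun a => ((F a).2.2 hp).le) b
    · exact le_meanExtension_add (hlip p.1) (hlip p.2) (fun a => ((F a).2.2 hp).ge) b
  refine ⟨fun b => ⟨⟨_, hX.hullCell_subset hf (hmem b)⟩, hmem b⟩,
    LipschitzWith.of_dist_le_mul fun b b' => ?_, fun a => ?_⟩
  · rw [NNReal.coe_one, one_mul]
    refine ciSup_le fun x => abs_le.2 ⟨?_, ?_⟩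
    · have := meanExtension_le_add_dist (hlip x) b' b
      rw [dist_comm] at this
      linarith
    · have := meanExtension_le_add_dist (hlip x) b b'
      linarith
  · exact Subtype.ext (Subtype.ext (funext fun x => meanExtension_coe (hlip x) a))

end Injective

/-! ### Assembly of the theorem -/

section Main

/-- Finitely many model spaces suffice to bound the number of isometry types. -/
theorem finitelyManyIsometryTypes_of_models {Y : Type v} [MetricSpace Y] {𝒞 : Set (Set Y)}
    {Z : Type w} [MetricSpace Z] {𝒦 : Set (Set Z)} (h𝒦 : 𝒦.Finite)
    (h : ∀ c ∈ 𝒞, ∃ K ∈ 𝒦, Nonempty (c ≃ᵢ K)) : FinitelyManyIsometryTypes 𝒞 := by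
  choose! κ hκ e using h
  obtain ⟨T, hT, hbij⟩ := Set.exists_subset_bijOn 𝒞 κ
  have hfin : (κ '' 𝒞).Finite := h𝒦.subset (Set.image_subset_iff.2 hκ)
  refine ⟨T, hT, Set.Finite.of_finite_image (by rwa [hbij.image_eq]) hbij.injOn, fun c hc => ?_⟩
  obtain ⟨t, ht, htc⟩ := hbij.surjOn ⟨c, hc, rfl⟩
  obtain ⟨e₁⟩ := e c hc
  obtain ⟨e₂⟩ := e t (hT ht)
  rw [htc] at e₂
  exact ⟨t, ht, ⟨e₁.trans e₂.symm⟩⟩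

theorem HasFiniteEdgePatterns.finite_trace_meeting {X : Type u} [MetricSpace X] [Nonempty X]
    (hX : HasFiniteEdgePatterns X) (f : InjectiveHull X) (r : ℝ) :
    {c ∈ hullCell '' extremalFunctions X |
      (InjectiveHull.trace c ∩ Metric.closedBall f r).Nonempty}.Finite := by
  obtain ⟨z⟩ := ‹Nonempty X›
  have : Nonempty X := ⟨z⟩
  refine (hX.finite_hullCell_meeting z (f.1 z + r)).subset ?_
  rintro c ⟨hc, g, hgc, hg⟩
  refine ⟨hc, g.1, hgc, ?_⟩
  have h1 : dist g f ≤ r := hg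
  have h2 : g.1 z - f.1 z ≤ dist g f :=
    (le_abs_self _).trans (le_ciSup (InjectiveHull.bddAbove_abs_sub g f) z)
  linarith

theorem theorem1p1 (X : Type u) [MetricSpace X] [Nonempty X]
    (hgeo : IsDiscretelyGeodesic X)
    (hfin : ∀ s : Set X, Bornology.IsBounded s → s.Finite)
    (β : ℝ) (hβ : 0 ≤ β) (hstable : HasStableIntervals X β) :
    ProperSpace (InjectiveHull X) ∧
    ∃ cells : Set (Set (X → ℝ)),
      IsPolyhedralComplex cells (extremalFunctions X) ∧
      LocallyFinite (fun c : cells => (InjectiveHull.trace c.1 : Set (InjectiveHull X))) ∧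
      ∀ n : ℕ,
        FinitelyManyIsometryTypes
          {C : Set (InjectiveHull X) | ∃ c ∈ cells, polytopeDim c = n ∧ C = InjectiveHull.trace c} ∧
        ∀ c ∈ cells, polytopeDim c = n →
          ∃ Q : Set (Fin n → ℝ), IsPolytope Q ∧ IsInjectiveMetricSpace.{0, w} Q ∧
            Nonempty ((InjectiveHull.trace c : Set (InjectiveHull X)) ≃ᵢ Q) := by
  have hX := hasFiniteEdgePatterns hgeo hfin hβ hstable
  refine ⟨⟨fun f r => ?_⟩, hullCell '' extremalFunctions X, hX.isPolyhedralComplex, ?_,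
    fun n => ⟨?_, ?_⟩⟩
  · refine IsCompact.of_isClosed_subset ((hX.finite_trace_meeting f r).isCompact_biUnion
      (f := InjectiveHull.trace) ?_) Metric.isClosed_closedBall ?_
    · rintro _ ⟨⟨g, hg, rfl⟩, -⟩
      -- `isCompact_hullCell` concerns the product topology; compactness for the supremum metric
      -- comes from the isometric model in ℓ_∞^n.
      obtain ⟨K, hK, -, ⟨e⟩⟩ := hX.exists_isometryEquiv_convexHull hgeo hg rfl
      have : CompactSpace (convexHull ℝ K) := isCompact_iff_compactSpace.1
        (((finite_halfIntegerGrid _).subset hK).isCompact_convexHull ℝ)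
      exact isCompact_iff_compactSpace.2 e.symm.toHomeomorph.compactSpace
    · intro g hg
      exact Set.mem_biUnion (x := hullCell g.1)
        ⟨⟨g.1, g.2, rfl⟩, g, self_mem_hullCell g.2, hg⟩ (self_mem_hullCell g.2)
  · intro f
    refine ⟨Metric.closedBall f 1, Metric.closedBall_mem_nhds f one_pos, ?_⟩
    refine Set.Finite.of_finite_image (f := Subtype.val)
      ((hX.finite_trace_meeting f 1).subset ?_) Subtype.val_injective.injOn
    rintro _ ⟨c, hc, rfl⟩
    exact ⟨c.2, hc⟩
  · refine finitelyManyIsometryTypes_of_models (Z := Fin n → ℝ)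
      ((finite_halfIntegerGrid n).finite_subsets.image (convexHull ℝ)) ?_
    rintro _ ⟨_, ⟨f, hf, rfl⟩, hn, rfl⟩
    obtain ⟨K, hK, -, he⟩ := hX.exists_isometryEquiv_convexHull hgeo hf hn
    exact ⟨_, ⟨K, hK, rfl⟩, he⟩
  · rintro _ ⟨f, hf, rfl⟩ hn
    obtain ⟨K, hK, hne, ⟨e⟩⟩ := hX.exists_isometryEquiv_convexHull hgeo hf hn
    exact ⟨convexHull ℝ K, ⟨K, (finite_halfIntegerGrid n).subset hK, hne, rfl⟩,
      (hX.isInjectiveMetricSpace_trace hf).of_isometryEquiv e, ⟨e⟩⟩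

end Main
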